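/- Let $A$ be a finite-dimensional semisimple $\mathbb{Q}$-algebra with Wedderburn-Artin decomposition $A\cong\prod_{i=1}^m M_{n_i}(D_i)$, where the $D_i$ are finite-dimensional division $\mathbb{Q}$-algebras, and let $h_i\colon A\to M_{n_i}(D_i)$ be the projections. Suppose that $M_{n_i}(D_i)\cong M_2(\mathbb{Q})$ as $\mathbb{Q}$-algebras for some $i$. Let $\mathcal{O}$ be an order in $A$, that is, a (unital) subring of $A$ which is finitely generated as an abelian group and spans $A$ over $\mathbb{Q}$, and let $$\operatorname{SL}_1(\mathcal{O})=\{a\in\mathcal{O}^\times \mid \operatorname{RNr}_{M_{n_i}(D_i)/\mathcal{Z}(D_i)}(h_i(a))=1 \text{ for all } i\}.$$ Here $\mathcal{Z}(D_i)$ is the centre of $D_i$, and for a finite-dimensional central simple algebra $B$ over a field $K$ the reduced norm of $b\in B$ is $\operatorname{RNr}_{B/K}(b)=\det(1\otimes b)$, computed in $E\otimes_K B\cong M_n(E)$ for a splitting field $E$ of $B$ (for example, an algebraic closure of $K$). Then every subgroup $H$ of finite index in $\operatorname{SL}_1(\mathcal{O})$ has a non-trivial amalgamated decomposition: there are groups $G_1,G_2,C$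 and injective, non-surjective homomorphisms $f_1\colon C\to G_1$ and $f_2\colon C\to G_2$ such that $H\cong G_1 *_C G_2$, where $G_1 *_C G_2$ is the quotient of the free product $G_1 * G_2$ by the normal subgroup generated by the elements $f_1(c)f_2(c)^{-1}$ with $c\in C$. -/

import Mathlib

open scoped TensorProduct

universe u

/-! ### Free products with amalgamation -/

/-- The free product with amalgamation `G₁ *_C G₂` along `f₁ : C → G₁` and `f₂ : C → G₂`: the
quotient of the free product `G₁ * G₂` by the normal subgroup generated by the elements
`f₁(h) f₂(h)⁻¹` for `h ∈ C`. -/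
abbrev AmalgamatedProduct {G₁ G₂ C : Type u} [Group G₁] [Group G₂] [Group C]
    (f₁ : C →* G₁) (f₂ : C →* G₂) : Type u :=
  Monoid.Coprod G₁ G₂ ⧸ Subgroup.normalClosure
    (Set.range fun h : C => (Monoid.Coprod.inl (f₁ h) * (Monoid.Coprod.inr (f₂ h))⁻¹ :
      Monoid.Coprod G₁ G₂))

/-- `G` has a non-trivial amalgamated decomposition: it is isomorphic to `G₁ *_C G₂` for
injective homomorphisms `C → G₁` and `C → G₂`, neither of which is surjective. (The factors embed
into `G`, so that it is no restriction to take them in the universe of `G`.) -/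
def HasNontrivialAmalgamatedDecomposition (G : Type u) [Group G] : Prop :=
  ∃ (G₁ G₂ C : Type u) (_ : Group G₁) (_ : Group G₂) (_ : Group C)
    (f₁ : C →* G₁) (f₂ : C →* G₂),
    Function.Injective f₁ ∧ Function.Injective f₂ ∧
    ¬ Function.Surjective f₁ ∧ ¬ Function.Surjective f₂ ∧
    Nonempty (G ≃* AmalgamatedProduct f₁ f₂)

/-! ### The reduced norm of a central simple algebra -/

section TensorSimple

variable {K E B : Type*} [Field K] [Field E] [Algebra K E] [Ring B] [Algebra K B]

theorem equivFinsupp_mul_mul {ι : Type*} [DecidableEq ι] (β : Module.Basis ι K E) (l r : B)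
    (x : E ⊗[K] B) (i : ι) :
    TensorProduct.equivFinsuppOfBasisLeft β ((1 ⊗ₜ l) * x * (1 ⊗ₜ r)) i =
      l * TensorProduct.equivFinsuppOfBasisLeft β x i * r := by
  induction x with
  | zero => simp
  | add x y hx hy => simp only [mul_add, add_mul, map_add, Finsupp.add_apply, hx, hy]
  | tmul e b =>
    simp [Algebra.TensorProduct.tmul_mul_tmul]

/-- Extending the scalars of a central simple algebra gives a simple ring. -/
theorem isSimpleRing_baseChange [Algebra.IsCentral K B] [IsSimpleRing B] :
    IsSimpleRing (E ⊗[K] B) := by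
  classical
  refine IsSimpleRing.of_eq_bot_or_eq_top fun I => ?_
  rw [or_iff_not_imp_left]
  intro hI
  let β := Module.Basis.ofVectorSpace K E
  let c := TensorProduct.equivFinsuppOfBasisLeft (N := B) β
  have key : ∀ n : ℕ, ∀ x ∈ I, x ≠ 0 → (c x).support.card = n → (1 : E ⊗[K] B) ∈ I := by
    intro n
    induction n using Nat.strong_induction_on with
    | _ n ih =>
      intro x hx hx0 hn
      obtain ⟨i, hi⟩ : (c x).support.Nonempty := by
        rw [Finsupp.support_nonempty_iff]
        exact fun h => hx0 (c.map_eq_zero_iff.mp h)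
      let J : TwoSidedIdeal B := TwoSidedIdeal.mk'
        {b | ∃ y ∈ I, (∀ j, c x j = 0 → c y j = 0) ∧ c y i = b}
        ⟨0, I.zero_mem, by simp, by simp⟩
        (by
          rintro a b ⟨y, hy, hs, rfl⟩ ⟨z, hz, ht, rfl⟩
          exact ⟨y + z, I.add_mem hy hz, fun j hj => by simp [hs j hj, ht j hj], by simp⟩)
        (by
          rintro a ⟨y, hy, hs, rfl⟩
          exact ⟨-y, I.neg_mem hy, fun j hj => by simp [hs j hj], by simp⟩)
        (by
          rintro a b ⟨y, hy, hs, rfl⟩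
          refine ⟨(1 ⊗ₜ a) * y * (1 ⊗ₜ 1),
            I.mul_mem_right _ _ (I.mul_mem_left _ _ hy), fun j hj => ?_, ?_⟩
          · simp only [c, equivFinsupp_mul_mul]
            simp only [c] at hs
            simp [hs j hj]
          · simp only [c, equivFinsupp_mul_mul, mul_one])
        (by
          rintro a b ⟨y, hy, hs, rfl⟩
          refine ⟨(1 ⊗ₜ 1) * y * (1 ⊗ₜ b),
            I.mul_mem_right _ _ (I.mul_mem_left _ _ hy), fun j hj => ?_, ?_⟩
          · simp only [c, equivFinsupp_mul_mul]
            simp only [c] at hs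
            simp [hs j hj]
          · simp only [c, equivFinsupp_mul_mul, one_mul])
      have hJ : (1 : B) ∈ J := by
        refine IsSimpleRing.one_mem_of_ne_zero_mem J (x := c x i)
          (Finsupp.mem_support_iff.mp hi) ?_
        exact (TwoSidedIdeal.mem_mk' _ _ _ _ _ _ _).mpr ⟨x, hx, fun _ h => h, rfl⟩
      obtain ⟨y, hy, hys, hyi⟩ := (TwoSidedIdeal.mem_mk' _ _ _ _ _ _ _).mp hJ
      have hcomm : ∀ b j, c ((1 ⊗ₜ b) * y - y * (1 ⊗ₜ b)) j = b * c y j - c y j * b := by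
        intro b j
        have h1 := equivFinsupp_mul_mul β b 1 y j
        have h2 := equivFinsupp_mul_mul β 1 b y j
        rw [← Algebra.TensorProduct.one_def] at h1 h2
        simp only [mul_one, one_mul] at h1 h2
        simp only [map_sub, Finsupp.sub_apply, c, h1, h2]
      by_cases hall : ∀ b, (1 ⊗ₜ b) * y - y * (1 ⊗ₜ b) = 0
      · have hcen : ∀ j, ∃ k : K, c y j = algebraMap K B k := by
          intro j
          rw [← Algebra.IsCentral.mem_center_iff K, Subalgebra.mem_center_iff]
          intro b
          have h := hcomm b j
          rw [hall b, map_zero, Finsupp.zero_apply] at h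
          exact (sub_eq_zero.mp h.symm)
        choose k hk using hcen
        have hye : y = (∑ j ∈ (c y).support, k j • β j) ⊗ₜ[K] (1 : B) := by
          calc y = c.symm (c y) := (c.symm_apply_apply y).symm
            _ = (c y).sum fun i n => β i ⊗ₜ n :=
              TensorProduct.equivFinsuppOfBasisLeft_symm_apply β (c y)
            _ = _ := by
              rw [Finsupp.sum, TensorProduct.sum_tmul]
              refine Finset.sum_congr rfl fun j _ => ?_
              rw [hk j, Algebra.algebraMap_eq_smul_one, TensorProduct.tmul_smul,
                TensorProduct.smul_tmul']
        set e := ∑ j ∈ (c y).support, k j • β j with he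
        have he0 : e ≠ 0 := by
          intro h
          rw [h, TensorProduct.zero_tmul] at hye
          rw [hye] at hyi
          simp at hyi
        have h1 : (e⁻¹ ⊗ₜ[K] (1 : B)) * y = 1 := by
          rw [hye, Algebra.TensorProduct.tmul_mul_tmul, inv_mul_cancel₀ he0, one_mul,
            Algebra.TensorProduct.one_def]
        rw [← h1]
        exact I.mul_mem_left _ _ hy
      · push Not at hall
        obtain ⟨b, hb⟩ := hall
        refine ih _ ?_ _ (I.sub_mem (I.mul_mem_left _ _ hy) (I.mul_mem_right _ _ hy)) hb rfl
        rw [← hn]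
        refine Finset.card_lt_card ⟨fun j hj => ?_, fun h => ?_⟩
        · rw [Finsupp.mem_support_iff, hcomm] at hj
          rw [Finsupp.mem_support_iff]
          intro h
          exact hj (by simp [hys j h])
        · have := h hi
          rw [Finsupp.mem_support_iff, hcomm, hyi] at this
          simp at this
  obtain ⟨x, hx, hx0⟩ := SetLike.exists_of_lt (bot_lt_iff_ne_bot.mpr hI)
  exact I.one_mem_iff.mp (key _ x hx (fun h => hx0 (h ▸ TwoSidedIdeal.zero_mem _)) rfl)

end TensorSimple

section ReducedNorm

variable (K : Type u) (B : Type*) [Field K] [Ring B] [Algebra K B]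

/-- A splitting `E ⊗_K B ≅ M_n(E)` of the `K`-algebra `B` over the algebraic closure `E` of `K`. -/
structure Splitting where
  n : ℕ
  equiv : AlgebraicClosure K ⊗[K] B ≃ₐ[AlgebraicClosure K]
    Matrix (Fin n) (Fin n) (AlgebraicClosure K)

variable {K B} in
/-- The map `b ↦ det(1 ⊗ b)` attached to a splitting. -/
noncomputable def Splitting.det (S : Splitting K B) : B →* AlgebraicClosure K :=
  Matrix.detMonoidHom.comp
    ((S.equiv : AlgebraicClosure K ⊗[K] B →* Matrix (Fin S.n) (Fin S.n) (AlgebraicClosure K)).comp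
      (Algebra.TensorProduct.includeRight (R := K) (A := AlgebraicClosure K) (B := B) :
        B →* AlgebraicClosure K ⊗[K] B))

variable [Algebra.IsCentral K B] [IsSimpleRing B] [FiniteDimensional K B]

/-- The algebraic closure of `K` is a splitting field of every central simple `K`-algebra. -/
theorem Splitting.nonempty : Nonempty (Splitting K B) := by
  have := isSimpleRing_baseChange (K := K) (E := AlgebraicClosure K) (B := B)
  obtain ⟨n, _, ⟨φ⟩⟩ := IsSimpleRing.exists_algEquiv_matrix_of_isAlgClosed
    (AlgebraicClosure K) (AlgebraicClosure K ⊗[K] B)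
  exact ⟨⟨n, φ⟩⟩

/-- The reduced norm of the central simple `K`-algebra `B`: the determinant of `1 ⊗ b` in
`E ⊗_K B ≅ M_n(E)`, with `E` the algebraic closure of `K`. Its values lie in `K`, here regarded
as a subfield of `E`. -/
noncomputable def reducedNorm : B →* AlgebraicClosure K :=
  (Classical.choice (Splitting.nonempty K B)).det

/-- The reduced norm does not depend on the splitting. -/
theorem reducedNorm_eq (S : Splitting K B) (b : B) : reducedNorm K B b = S.det b := by
  let S' := Classical.choice (Splitting.nonempty K B)
  change S'.det b = S.det b
  let ψ := (Matrix.toLinAlgEquiv' (R := AlgebraicClosure K) (n := Fin S'.n)).symm.trans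
    (S'.equiv.symm.trans (S.equiv.trans (Matrix.toLinAlgEquiv' (R := AlgebraicClosure K))))
  obtain ⟨T, hT⟩ := AlgEquiv.eq_linearEquivConjAlgEquiv ψ
  have h : ψ (Matrix.toLinAlgEquiv' (S'.equiv (1 ⊗ₜ b))) =
      Matrix.toLinAlgEquiv' (S.equiv (1 ⊗ₜ b)) := by
    simp [ψ]
  have h1 : S'.det b = LinearMap.det (Matrix.toLinAlgEquiv' (S'.equiv (1 ⊗ₜ b))) :=
    (LinearMap.det_toLin' _).symm
  have h2 : S.det b = LinearMap.det (Matrix.toLinAlgEquiv' (S.equiv (1 ⊗ₜ b))) :=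
    (LinearMap.det_toLin' _).symm
  rw [h1, h2, ← h, hT, LinearEquiv.conjAlgEquiv_apply]
  exact (LinearMap.det_conj _ T).symm

end ReducedNorm

/-! ### Matrix algebras over division algebras are central simple over the centre -/

instance isCentral_center (D : Type*) [DivisionRing D] :
    Algebra.IsCentral (Subring.center D) D where
  out x hx := Algebra.mem_bot.mpr ⟨⟨x, hx⟩, rfl⟩

instance finiteDimensional_center (D : Type*) [DivisionRing D] [Algebra ℚ D]
    [FiniteDimensional ℚ D] : FiniteDimensional (Subring.center D) D := by
  let f : ℚ →+* Subring.center D := (algebraMap ℚ D).codRestrict (Subring.center D)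
    fun q => Set.algebraMap_mem_center q
  let _ : Algebra ℚ (Subring.center D) := f.toAlgebra
  have : IsScalarTower ℚ (Subring.center D) D := IsScalarTower.of_algebraMap_eq fun _ => rfl
  exact Module.Finite.of_restrictScalars_finite ℚ (Subring.center D) D

/-! ### Wedderburn-Artin decompositions, orders and `SL₁` -/

/-- A Wedderburn-Artin decomposition `A ≅ M_{n₁}(D₁) × ⋯ × M_{nₘ}(Dₘ)` of a `ℚ`-algebra, with
finite-dimensional division `ℚ`-algebras `Dᵢ` and positive integers `nᵢ`. -/
structure WedderburnDecomposition (A : Type u) [Ring A] [Algebra ℚ A] where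
  m : ℕ
  n : Fin m → ℕ
  D : Fin m → Type u
  [neZero : ∀ i, NeZero (n i)]
  [divisionRing : ∀ i, DivisionRing (D i)]
  [algebra : ∀ i, Algebra ℚ (D i)]
  [finiteDimensional : ∀ i, FiniteDimensional ℚ (D i)]
  equiv : A ≃ₐ[ℚ] ((i : Fin m) → Matrix (Fin (n i)) (Fin (n i)) (D i))

namespace WedderburnDecomposition

attribute [instance] neZero divisionRing algebra finiteDimensional

variable {A : Type u} [Ring A] [Algebra ℚ A]

/-- Every finite-dimensional semisimple `ℚ`-algebra has a Wedderburn-Artin decomposition. -/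
theorem nonempty [FiniteDimensional ℚ A] [IsSemisimpleRing A] :
    Nonempty (WedderburnDecomposition A) := by
  obtain ⟨m, D, n, _, _, _, _, ⟨e⟩⟩ :=
    IsSemisimpleRing.exists_algEquiv_pi_matrix_divisionRing_finite ℚ A
  exact ⟨{ m := m, n := n, D := D, equiv := e }⟩

/-- The `i`-th simple component `M_{nᵢ}(Dᵢ)`. -/
abbrev Component (W : WedderburnDecomposition A) (i : Fin W.m) : Type u :=
  Matrix (Fin (W.n i)) (Fin (W.n i)) (W.D i)

/-- The projection `hᵢ` of `A` onto the `i`-th simple component. -/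
def proj (W : WedderburnDecomposition A) (i : Fin W.m) : A →ₐ[ℚ] W.Component i :=
  (Pi.evalAlgHom ℚ (fun j => W.Component j) i).comp (W.equiv : A →ₐ[ℚ] _)

/-- `SL₁(R)` for a subring `R` of `A`: the units of `R` whose image in each simple component
`M_{nᵢ}(Dᵢ)` has reduced norm `1` over the centre of `Dᵢ`. -/
noncomputable def SL1 (W : WedderburnDecomposition A) (R : Subring A) : Subgroup Rˣ where
  carrier := {a | ∀ i, reducedNorm (Subring.center (W.D i)) (W.Component i)
    (W.proj i ((a : R) : A)) = 1}
  one_mem' := fun i => by simp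
  mul_mem' := fun {a b} ha hb i => by
    have ha := ha i
    have hb := hb i
    simp only [Units.val_mul, Subring.coe_mul, map_mul, ha, hb, mul_one]
  inv_mem' := fun {a} ha i => by
    have h : reducedNorm (Subring.center (W.D i)) (W.Component i)
        (W.proj i (((a * a⁻¹ : Rˣ) : R) : A)) = 1 := by simp
    have ha := ha i
    simpa only [Units.val_mul, Subring.coe_mul, map_mul, ha, one_mul] using h

end WedderburnDecomposition

/-- A subring `O` of a finite-dimensional `ℚ`-algebra `A` is an order in `A` if it is finitely
generated as an abelian group and spans `A` over `ℚ`. -/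
structure IsOrderIn {A : Type*} [Ring A] [Algebra ℚ A] (O : Subring A) : Prop where
  fg : O.toAddSubgroup.FG
  span_eq_top : Submodule.span ℚ (O : Set A) = ⊤

/-! It suffices to map `H` onto a free product `M * N` of two non-trivial groups: `H` is then the
amalgam of the preimages of `M` and `N` over the kernel of the map
(`HasNontrivialAmalgamatedDecomposition.of_surjective`). So no tree action of `H` is needed, and
kernels may be ignored throughout.

The component `M₂(ℚ)` supplies the map. After a conjugation it sends the order into `M₂(ℤ)`, and the
reduced norm there is the determinant, so `SL₁(O)` maps to `SL₂(ℤ)`. The image contains a principal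
congruence subgroup: for suitable `N`, an element of `Γ(N)` extended by `1` in the other components
lies in `O`. Hence the image of `H` has finite index in `SL₂(ℤ)`. Since `SL₂(ℤ)` maps onto `C₂ *
C₃`, by ping-pong on quadratic forms, `H` maps onto a finite-index subgroup `K` of `C₂ * C₃`.

By Kurosh such a `K` is a free product of copies of `C₂`, `C₃` and `ℤ`, with at least two factors by
an Euler characteristic count. Only a quotient of this structure is built. The cosets of `K` form a
graph whose vertices are the orbits of `t` and whose edges are the orbits of `s`. Outside a spanning
tree, the count leaves at least two independent places, each an unused edge (label in `C₂`) or a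
fixed point of `t` (label in `C₃`). Multiplying labels along closed paths maps `K` onto the free
product of the two label groups. -/

/-! ### Amalgamated decompositions from surjections onto free products -/

/-- A group that maps onto a free product of two non-trivial groups is the amalgamated product of
the preimages of the factors along the kernel. -/
theorem HasNontrivialAmalgamatedDecomposition.of_surjective {G : Type u} [Group G]
    {M N : Type*} [Group M] [Group N] [Nontrivial M] [Nontrivial N]
    (π : G →* Monoid.Coprod M N) (hπ : Function.Surjective π) :
    HasNontrivialAmalgamatedDecomposition G := by
  let G₁ : Subgroup G := (Monoid.Coprod.inl : M →* Monoid.Coprod M N).range.comap π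
  let G₂ : Subgroup G := (Monoid.Coprod.inr : N →* Monoid.Coprod M N).range.comap π
  let C : Subgroup G := π.ker
  have h₁ : C ≤ G₁ := fun x hx => ⟨1, by rw [map_one]; exact (MonoidHom.mem_ker.mp hx).symm⟩
  have h₂ : C ≤ G₂ := fun x hx => ⟨1, by rw [map_one]; exact (MonoidHom.mem_ker.mp hx).symm⟩
  let f₁ : C →* G₁ := Subgroup.inclusion h₁
  let f₂ : C →* G₂ := Subgroup.inclusion h₂
  refine ⟨G₁, G₂, C, inferInstance, inferInstance, inferInstance, f₁, f₂,
    Subgroup.inclusion_injective _, Subgroup.inclusion_injective _, ?_, ?_, ?_⟩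
  · intro hs
    obtain ⟨m, hm⟩ := exists_ne (1 : M)
    obtain ⟨g, hg⟩ := hπ (Monoid.Coprod.inl m)
    obtain ⟨c, hc⟩ := hs ⟨g, m, hg.symm⟩
    have hcg : (c : G) = g := congrArg Subtype.val hc
    have : π g = 1 := hcg ▸ c.2
    rw [hg] at this
    exact hm (Monoid.Coprod.inl_injective (this.trans (map_one _).symm))
  · intro hs
    obtain ⟨m, hm⟩ := exists_ne (1 : N)
    obtain ⟨g, hg⟩ := hπ (Monoid.Coprod.inr m)
    obtain ⟨c, hc⟩ := hs ⟨g, m, hg.symm⟩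
    have hcg : (c : G) = g := congrArg Subtype.val hc
    have : π g = 1 := hcg ▸ c.2
    rw [hg] at this
    exact hm (Monoid.Coprod.inr_injective (this.trans (map_one _).symm))
  · let R : Subgroup (Monoid.Coprod G₁ G₂) := Subgroup.normalClosure
      (Set.range fun h : C => Monoid.Coprod.inl (f₁ h) * (Monoid.Coprod.inr (f₂ h))⁻¹)
    let ι₁ : G₁ →* AmalgamatedProduct f₁ f₂ := (QuotientGroup.mk' R).comp Monoid.Coprod.inl
    let ι₂ : G₂ →* AmalgamatedProduct f₁ f₂ := (QuotientGroup.mk' R).comp Monoid.Coprod.inr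
    have hι : ∀ c : C, ι₁ (f₁ c) = ι₂ (f₂ c) := by
      intro c
      rw [← mul_inv_eq_one]
      change QuotientGroup.mk' R _ * (QuotientGroup.mk' R _)⁻¹ = 1
      rw [← map_inv, ← map_mul, ← MonoidHom.mem_ker, QuotientGroup.ker_mk']
      exact Subgroup.subset_normalClosure ⟨c, rfl⟩
    have hext : ∀ {X : Type _} [Group X] (α β : AmalgamatedProduct f₁ f₂ →* X),
        (∀ x, α (ι₁ x) = β (ι₁ x)) → (∀ x, α (ι₂ x) = β (ι₂ x)) → α = β := by
      intro X _ α β h h'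
      refine QuotientGroup.monoidHom_ext R (Monoid.Coprod.hom_ext ?_ ?_)
      · ext x; exact h x
      · ext x; exact h' x
    have hgen : ∀ S : Subgroup (AmalgamatedProduct f₁ f₂), ι₁.range ≤ S → ι₂.range ≤ S →
        ∀ p, p ∈ S := by
      intro S hS₁ hS₂ p
      obtain ⟨p, rfl⟩ := QuotientGroup.mk'_surjective R p
      have : (⊤ : Subgroup (Monoid.Coprod G₁ G₂)) ≤ S.comap (QuotientGroup.mk' R) := by
        rw [← Monoid.Coprod.range_inl_sup_range_inr, sup_le_iff]
        constructor
        · rintro _ ⟨x, rfl⟩; exact hS₁ ⟨x, rfl⟩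
        · rintro _ ⟨x, rfl⟩; exact hS₂ ⟨x, rfl⟩
      exact this (Subgroup.mem_top p)
    let Θ : AmalgamatedProduct f₁ f₂ →* G :=
      QuotientGroup.lift R (Monoid.Coprod.lift G₁.subtype G₂.subtype) (by
        refine Subgroup.normalClosure_le_normal ?_
        rintro _ ⟨c, rfl⟩
        simp [f₁, f₂, MonoidHom.mem_ker])
    have hΘ₁ : ∀ x, Θ (ι₁ x) = x := fun x => by simp [Θ, ι₁]
    have hΘ₂ : ∀ x, Θ (ι₂ x) = x := fun x => by simp [Θ, ι₂]
    -- `C` is a kernel, so its image is normalised by both factors, hence by the whole amalgam.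
    -- Injectivity of `Θ` is tested modulo this image.
    let K : Subgroup (AmalgamatedProduct f₁ f₂) := (ι₁.comp f₁).range
    have hK : K.Normal := by
      rw [← Subgroup.normalizer_eq_top_iff, eq_top_iff]
      intro p _
      refine hgen _ ?_ ?_ p
      · rintro _ ⟨x, rfl⟩
        rw [Subgroup.mem_normalizer_iff]
        intro h
        constructor
        · rintro ⟨c, rfl⟩
          refine ⟨⟨x * c * x⁻¹, by simp [C, MonoidHom.mem_ker, show π c = 1 from c.2]⟩, ?_⟩
          simp only [MonoidHom.comp_apply, ← map_inv, ← map_mul]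
          rfl
        · rintro ⟨c, hc⟩
          refine ⟨⟨x⁻¹ * c * x, by simp [C, MonoidHom.mem_ker, show π c = 1 from c.2]⟩, ?_⟩
          rw [show h = (ι₁ x)⁻¹ * (ι₁ x * h * (ι₁ x)⁻¹) * ι₁ x by group, ← hc]
          simp only [MonoidHom.comp_apply, ← map_inv, ← map_mul]
          rfl
      · rintro _ ⟨x, rfl⟩
        rw [Subgroup.mem_normalizer_iff]
        intro h
        constructor
        · rintro ⟨c, rfl⟩
          refine ⟨⟨x * c * x⁻¹, by simp [C, MonoidHom.mem_ker, show π c = 1 from c.2]⟩, ?_⟩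
          simp only [MonoidHom.comp_apply, hι, ← map_inv, ← map_mul]
          rfl
        · rintro ⟨c, hc⟩
          refine ⟨⟨x⁻¹ * c * x, by simp [C, MonoidHom.mem_ker, show π c = 1 from c.2]⟩, ?_⟩
          rw [show h = (ι₂ x)⁻¹ * (ι₂ x * h * (ι₂ x)⁻¹) * ι₂ x by group, ← hc]
          simp only [MonoidHom.comp_apply, hι, ← map_inv, ← map_mul]
          rfl
    -- `M * N` maps back to the amalgam modulo the image of `C`
    let κ := QuotientGroup.mk' K
    have hκ₁ : ∀ x : G₁, π x = 1 → κ (ι₁ x) = 1 := fun x hx => by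
      rw [← MonoidHom.mem_ker, QuotientGroup.ker_mk']
      exact ⟨⟨x, hx⟩, rfl⟩
    have hκ₂ : ∀ x : G₂, π x = 1 → κ (ι₂ x) = 1 := fun x hx => by
      rw [← MonoidHom.mem_ker, QuotientGroup.ker_mk']
      exact ⟨⟨x, hx⟩, (hι ⟨x, hx⟩).trans rfl⟩
    have hs₁ : ∀ m : M, ∃ x : G₁, π x = Monoid.Coprod.inl m := fun m => by
      obtain ⟨g, hg⟩ := hπ (Monoid.Coprod.inl m)
      exact ⟨⟨g, m, hg.symm⟩, hg⟩
    have hs₂ : ∀ m : N, ∃ x : G₂, π x = Monoid.Coprod.inr m := fun m => by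
      obtain ⟨g, hg⟩ := hπ (Monoid.Coprod.inr m)
      exact ⟨⟨g, m, hg.symm⟩, hg⟩
    choose s₁ hs₁ using hs₁
    choose s₂ hs₂ using hs₂
    have hd₁ : ∀ x y : G₁, π x = π y → κ (ι₁ x) = κ (ι₁ y) := fun x y h => by
      rw [← inv_mul_eq_one, ← map_inv, ← map_inv, ← map_mul, ← map_mul]
      exact hκ₁ _ (by simp [h])
    have hd₂ : ∀ x y : G₂, π x = π y → κ (ι₂ x) = κ (ι₂ y) := fun x y h => by
      rw [← inv_mul_eq_one, ← map_inv, ← map_inv, ← map_mul, ← map_mul]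
      exact hκ₂ _ (by simp [h])
    let a₁ : M →* AmalgamatedProduct f₁ f₂ ⧸ K := MonoidHom.mk' (fun m => κ (ι₁ (s₁ m)))
      fun m m' => by
        rw [← map_mul, ← map_mul]
        exact hd₁ _ _ (by simp [hs₁])
    let a₂ : N →* AmalgamatedProduct f₁ f₂ ⧸ K := MonoidHom.mk' (fun m => κ (ι₂ (s₂ m)))
      fun m m' => by
        rw [← map_mul, ← map_mul]
        exact hd₂ _ _ (by simp [hs₂])
    -- Since `κ` factors through `Θ`, an element killed by `Θ` comes from `C`, and `Θ` is the
    -- identity on `C`.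
    have hcomp : ((Monoid.Coprod.lift a₁ a₂).comp π).comp Θ = κ := by
      refine hext _ _ (fun x => ?_) fun x => ?_
      · obtain ⟨m, hm⟩ := x.2
        simp only [MonoidHom.comp_apply, hΘ₁, ← hm, Monoid.Coprod.lift_apply_inl]
        exact hd₁ _ _ ((hs₁ m).trans hm)
      · obtain ⟨m, hm⟩ := x.2
        simp only [MonoidHom.comp_apply, hΘ₂, ← hm, Monoid.Coprod.lift_apply_inr]
        exact hd₂ _ _ ((hs₂ m).trans hm)
    have hinj : Function.Injective Θ := by
      rw [injective_iff_map_eq_one]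
      intro p hp
      have : κ p = 1 := by rw [← hcomp]; simp [hp]
      rw [← MonoidHom.mem_ker, QuotientGroup.ker_mk'] at this
      obtain ⟨c, rfl⟩ := this
      have hc : (c : G) = 1 := by
        rw [← hp, MonoidHom.comp_apply, hΘ₁]; rfl
      rw [show c = 1 from Subtype.ext hc, map_one]
    have hrange : Function.Surjective (π.comp Θ) := by
      rw [← MonoidHom.range_eq_top, eq_top_iff, ← Monoid.Coprod.range_inl_sup_range_inr,
        sup_le_iff]
      constructor
      · rintro _ ⟨m, rfl⟩
        exact ⟨ι₁ (s₁ m), by simp [hΘ₁, hs₁]⟩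
      · rintro _ ⟨m, rfl⟩
        exact ⟨ι₂ (s₂ m), by simp [hΘ₂, hs₂]⟩
    -- `Θ` meets every coset of the kernel of `π`, and its image contains that kernel `C`.
    have hsurj : Function.Surjective Θ := by
      intro g
      obtain ⟨p, hp⟩ := hrange (π g)
      have hc : (Θ p)⁻¹ * g ∈ C := by
        rw [MonoidHom.comp_apply] at hp
        simp [C, MonoidHom.mem_ker, hp]
      exact ⟨p * ι₁ (f₁ ⟨_, hc⟩), by rw [map_mul, hΘ₁]; simp [f₁]⟩
    exact ⟨(MulEquiv.ofBijective Θ ⟨hinj, hsurj⟩).symm⟩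

/-! ### The modular group modulo its centre as a free product -/

/-- The free product of a cyclic group of order two and one of order three, indexed by `Bool`. -/
abbrev FreeProductTwoThree : Type :=
  Monoid.CoprodI fun b : Bool => Multiplicative (ZMod (if b then 3 else 2))

namespace FreeProductTwoThree

/-- The generator of order two. -/
def s : FreeProductTwoThree :=
  Monoid.CoprodI.of (M := fun b : Bool => Multiplicative (ZMod (if b then 3 else 2)))
    (i := false) (Multiplicative.ofAdd 1)

/-- The generator of order three. -/
def t : FreeProductTwoThree :=
  Monoid.CoprodI.of (M := fun b : Bool => Multiplicative (ZMod (if b then 3 else 2)))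
    (i := true) (Multiplicative.ofAdd 1)

theorem s_sq : s ^ 2 = 1 := by
  rw [s, ← map_pow]
  exact (congrArg _ (by decide)).trans (map_one _)

theorem t_cube : t ^ 3 = 1 := by
  rw [t, ← map_pow]
  exact (congrArg _ (by decide)).trans (map_one _)

theorem closure_eq_top : Subgroup.closure {s, t} = ⊤ := by
  rw [Subgroup.eq_top_iff']
  intro x
  have hs : s ∈ Subgroup.closure {s, t} := Subgroup.subset_closure (by simp)
  have ht : t ∈ Subgroup.closure {s, t} := Subgroup.subset_closure (by simp)
  induction x using Monoid.CoprodI.induction_on with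
  | one => exact one_mem _
  | mul x y hx hy => exact mul_mem hx hy
  | of i m =>
    cases i with
    | false =>
      have : m = (Multiplicative.ofAdd (1 : ZMod 2)) ^ (Multiplicative.toAdd m).val := by
        revert m; change ∀ m : Multiplicative (ZMod 2), m = _; decide
      rw [this, map_pow]
      exact pow_mem hs _
    | true =>
      have : m = (Multiplicative.ofAdd (1 : ZMod 3)) ^ (Multiplicative.toAdd m).val := by
        revert m; change ∀ m : Multiplicative (ZMod 3), m = _; decide
      rw [this, map_pow]
      exact pow_mem ht _

/-- The homomorphism out of a cyclic group given by the image of the generator. -/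
def zmodLift {Y : Type*} [Group Y] (n : ℕ) (y : Y) (h : y ^ n = 1) :
    Multiplicative (ZMod n) →* Y :=
  AddMonoidHom.toMultiplicativeLeft (ZMod.lift n
    ⟨zmultiplesHom (Additive Y) (Additive.ofMul y), by
      simpa using congrArg Additive.ofMul h⟩)

theorem zmodLift_ofAdd_one {Y : Type*} [Group Y] (n : ℕ) (y : Y) (h : y ^ n = 1) :
    zmodLift n y h (Multiplicative.ofAdd 1) = y := by
  have := ZMod.lift_coe n (⟨zmultiplesHom (Additive Y) (Additive.ofMul y), by
      simpa using congrArg Additive.ofMul h⟩ : {f : ℤ →+ Additive Y // f n = 0}) 1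
  rw [Int.cast_one] at this
  simp [zmodLift, this]

/-- The homomorphisms from the two factors attached to an involution and an element of order
three. -/
def factorLift {Y : Type*} [Group Y] (a b : Y) (ha : a ^ 2 = 1) (hb : b ^ 3 = 1) (i : Bool) :
    Multiplicative (ZMod (if i then 3 else 2)) →* Y :=
  match i with
  | false => zmodLift 2 a ha
  | true => zmodLift 3 b hb

/-- The universal property of `C₂ * C₃`. -/
theorem exists_hom {Y : Type*} [Group Y] (a b : Y) (ha : a ^ 2 = 1) (hb : b ^ 3 = 1) :
    ∃ φ : FreeProductTwoThree →* Y, φ s = a ∧ φ t = b := by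
  refine ⟨Monoid.CoprodI.lift (factorLift a b ha hb), ?_, ?_⟩
  · rw [s, Monoid.CoprodI.lift_of]; exact zmodLift_ofAdd_one _ _ ‹_›
  · rw [t, Monoid.CoprodI.lift_of]; exact zmodLift_ofAdd_one _ _ ‹_›

end FreeProductTwoThree

/-- The action of `2 × 2` matrices on binary quadratic forms `(a, b, d)`. -/
def formAct (g : Matrix (Fin 2) (Fin 2) ℤ) (v : ℤ × ℤ × ℤ) : ℤ × ℤ × ℤ :=
  (g 0 0 * g 0 0 * v.1 + 2 * (g 0 0 * g 0 1) * v.2.1 + g 0 1 * g 0 1 * v.2.2,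
   g 0 0 * g 1 0 * v.1 + (g 0 0 * g 1 1 + g 0 1 * g 1 0) * v.2.1 + g 0 1 * g 1 1 * v.2.2,
   g 1 0 * g 1 0 * v.1 + 2 * (g 1 0 * g 1 1) * v.2.1 + g 1 1 * g 1 1 * v.2.2)

theorem formAct_one (v : ℤ × ℤ × ℤ) : formAct 1 v = v := by
  simp [formAct]

theorem formAct_mul (g h : Matrix (Fin 2) (Fin 2) ℤ) (v : ℤ × ℤ × ℤ) :
    formAct (g * h) v = formAct g (formAct h v) := by
  simp only [formAct, Matrix.mul_apply, Fin.sum_univ_two, Prod.mk.injEq]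
  refine ⟨?_, ?_, ?_⟩ <;> ring

/-- The action of `SL₂(ℤ)` on binary quadratic forms. -/
def formHom : Matrix.SpecialLinearGroup (Fin 2) ℤ →* Equiv.Perm (ℤ × ℤ × ℤ) :=
  @MulAction.toPermHom _ (ℤ × ℤ × ℤ) _
    { smul := fun g v => formAct g v
      one_smul := fun v => by
        change formAct ((1 : Matrix.SpecialLinearGroup (Fin 2) ℤ) : Matrix (Fin 2) (Fin 2) ℤ) v = v
        rw [Matrix.SpecialLinearGroup.coe_one, formAct_one]
      mul_smul := fun g h v => by
        change formAct ((g * h : Matrix.SpecialLinearGroup (Fin 2) ℤ) :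
          Matrix (Fin 2) (Fin 2) ℤ) v = formAct g (formAct h v)
        rw [Matrix.SpecialLinearGroup.coe_mul, formAct_mul] }

theorem formHom_apply (g : Matrix.SpecialLinearGroup (Fin 2) ℤ) (v : ℤ × ℤ × ℤ) :
    formHom g v = formAct g v := rfl

open FreeProductTwoThree in
/-- `SL₂(ℤ)` maps onto the free product of cyclic groups of orders two and three. -/
theorem exists_surjective_freeProductTwoThree :
    ∃ φ : Matrix.SpecialLinearGroup (Fin 2) ℤ →* FreeProductTwoThree, Function.Surjective φ := by
  -- A triple `(a, b, d)` is the symmetric matrix with rows `(a, b)` and `(b, d)`, acted on by `g M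
  -- gᵀ`. Both `S ^ 2` and `(T * S) ^ 3` equal `-1`, which acts trivially.
  let a := formHom ModularGroup.S
  let b := formHom (ModularGroup.T * ModularGroup.S)
  have ha' : ∀ v, a v = (v.2.2, -v.2.1, v.1) := fun v => by
    change formHom _ v = _
    rw [formHom_apply]
    simp [formAct, ModularGroup.S]
  have hb' : ∀ v, b v = (v.1 - 2 * v.2.1 + v.2.2, v.1 - v.2.1, v.1) := fun v => by
    change formHom _ v = _
    rw [formHom_apply, Matrix.SpecialLinearGroup.coe_mul]
    simp only [formAct, ModularGroup.S, ModularGroup.T, Matrix.mul_apply, Fin.sum_univ_two,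
      Matrix.of_apply, Matrix.cons_val', Matrix.cons_val_zero, Matrix.cons_val_one,
      Matrix.cons_val_fin_one, Prod.mk.injEq]
    refine ⟨?_, ?_, ?_⟩ <;> ring
  have ha : a ^ 2 = 1 := by
    ext1 v
    simp [pow_two, ha']
  have hb : b ^ 3 = 1 := by
    ext1 v
    simp only [pow_three, Equiv.Perm.mul_apply, hb', Equiv.Perm.one_apply]
    ext <;> simp <;> ring
  let ψ : FreeProductTwoThree →* Equiv.Perm (ℤ × ℤ × ℤ) :=
    Monoid.CoprodI.lift (factorLift a b ha hb)
  have hψs : ψ s = a := (Monoid.CoprodI.lift_of ..).trans (zmodLift_ofAdd_one _ _ ‹_›)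
  have hψt : ψ t = b := (Monoid.CoprodI.lift_of ..).trans (zmodLift_ofAdd_one _ _ ‹_›)
  have hinj : Function.Injective ψ := by
    -- The sign of the middle coefficient separates the two sets: `s` reverses it, while `t` and `t
    -- ^ 2` turn negative into positive. Ping-pong with two factors needs one of them to have at
    -- least three elements.
    let X : Bool → Set (ℤ × ℤ × ℤ) := fun i =>
      match i with
      | false => {v | 0 ≤ v.1 ∧ 0 ≤ v.2.2 ∧ v.2.1 < 0}
      | true => {v | 0 ≤ v.1 ∧ 0 ≤ v.2.2 ∧ 0 < v.2.1}
    refine Monoid.CoprodI.lift_injective_of_ping_pong _ (Or.inr ⟨true, ?_⟩) X ?_ ?_ ?_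
    · change 3 ≤ Cardinal.mk (Multiplicative (ZMod 3))
      rw [Cardinal.mk_fintype, Fintype.card_multiplicative, ZMod.card]
      norm_num
    · rintro (_ | _)
      · exact ⟨(0, -1, 0), by simp [X]⟩
      · exact ⟨(0, 1, 0), by simp [X]⟩
    · rintro (_ | _) (_ | _) h
      · exact absurd rfl h
      · exact Set.disjoint_left.mpr fun v hv hv' => lt_asymm hv.2.2 hv'.2.2
      · exact Set.disjoint_left.mpr fun v hv hv' => lt_asymm hv.2.2 hv'.2.2
      · exact absurd rfl h
    · rintro (_ | _) (_ | _) h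
      · exact absurd rfl h
      · intro m hm
        have : m = Multiplicative.ofAdd (1 : ZMod 2) := by
          revert m; change ∀ m : Multiplicative (ZMod 2), _; decide
        rw [this]
        rintro _ ⟨v, ⟨h1, h2, h3⟩, rfl⟩
        change zmodLift 2 a ha _ v ∈ _
        rw [zmodLift_ofAdd_one, ha']
        exact ⟨h2, h1, by simpa using h3⟩
      · intro m hm
        have : m = Multiplicative.ofAdd (1 : ZMod 3) ∨
            m = Multiplicative.ofAdd (1 : ZMod 3) * Multiplicative.ofAdd (1 : ZMod 3) := by
          revert m; change ∀ m : Multiplicative (ZMod 3), _; decide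
        rintro _ ⟨v, ⟨h1, h2, h3⟩, rfl⟩
        change zmodLift 3 b hb _ v ∈ _
        rcases this with rfl | rfl
        · rw [zmodLift_ofAdd_one, hb']
          refine ⟨?_, h1, ?_⟩ <;> dsimp only <;> linarith
        · rw [map_mul, zmodLift_ofAdd_one, Equiv.Perm.mul_apply, hb', hb']
          refine ⟨?_, ?_, ?_⟩ <;> dsimp only <;> linarith
      · exact absurd rfl h
  -- As `T = (T * S) * S⁻¹`, both images have the same generators. Composing `formHom` with the
  -- inverse of `ψ` avoids any presentation of `SL₂(ℤ)`.
  have hrange : formHom.range = ψ.range := by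
    refine le_antisymm ?_ ?_
    · rw [MonoidHom.range_eq_map, ← SpecialLinearGroup.SL2Z_generators,
        MonoidHom.map_closure, Subgroup.closure_le]
      rintro _ ⟨g, rfl | rfl, rfl⟩
      · exact ⟨s, hψs⟩
      · refine ⟨t * s⁻¹, ?_⟩
        rw [map_mul, map_inv, hψs, hψt]
        simp [a, b]
    · rw [MonoidHom.range_eq_map, ← closure_eq_top, MonoidHom.map_closure, Subgroup.closure_le]
      rintro _ ⟨g, rfl | rfl, rfl⟩
      · exact ⟨_, hψs.symm⟩
      · exact ⟨_, hψt.symm⟩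
  let ε := MonoidHom.ofInjective hinj
  let e : formHom.range ≃* ψ.range := MulEquiv.subgroupCongr hrange
  refine ⟨(ε.symm.toMonoidHom.comp e.toMonoidHom).comp formHom.rangeRestrict, ?_⟩
  exact (ε.symm.surjective.comp e.surjective).comp formHom.rangeRestrict_surjective

/-! ### Finite-index subgroups of `C₂ * C₃` -/

section Combinatorics

open Relation Finset

variable {Q : Type*} [DecidableEq Q] (σ τ : Equiv.Perm Q)

/-- A partial spanning tree of the graph whose vertices are the orbits of a permutation `τ` of
order three and whose edges are the orbits of an involution `σ`: the set `R` is the union of the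
vertices reached and `E` is the union of the edges used. -/
structure IsPartialTree (q₀ : Q) (R E : Finset Q) : Prop where
  base : q₀ ∈ R
  map_mem : ∀ q ∈ R, τ q ∈ R
  edge : ∀ q ∈ E, σ q ∈ E ∧ σ q ≠ q
  subset : E ⊆ R
  reach : ∀ q ∈ R, ReflTransGen (fun a b => b = τ a ∨ a ∈ E ∧ b = σ a) q₀ q
  -- A tree with `V` vertices has `V - 1` edges of two elements each, so the left side is `6 * V`.
  -- On the right every orbit counts `6`, whether it has three elements or one.
  card : 3 * #E + 6 = 2 * #R + 4 * #{q ∈ R | τ q = q}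

variable {σ τ}

theorem card_orbit_three (hτ : ∀ q, τ (τ (τ q)) = q) (q : Q) :
    2 * #{q, τ q, τ (τ q)} + 4 * #{x ∈ ({q, τ q, τ (τ q)} : Finset Q) | τ x = x} = 6 := by
  by_cases h : τ q = q
  · simp [h, filter_singleton]
  · have h1 : τ (τ q) ≠ τ q := fun h' => h (τ.injective h')
    have h2 : τ (τ q) ≠ q := fun h' => h (by rw [← h', hτ, h'])
    have h3 : ∀ x ∈ ({q, τ q, τ (τ q)} : Finset Q), ¬ τ x = x := by
      intro x hx
      simp only [mem_insert, mem_singleton] at hx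
      rcases hx with rfl | rfl | rfl
      · exact h
      · exact h1
      · rw [hτ]; exact h2.symm
    rw [filter_false_of_mem h3, card_insert_of_notMem, card_pair h1.symm]
    · simp
    · simp [Ne.symm h, h2.symm]

theorem IsPartialTree.singleton (hτ : ∀ q, τ (τ (τ q)) = q) (q₀ : Q) :
    IsPartialTree σ τ q₀ {q₀, τ q₀, τ (τ q₀)} ∅ where
  base := by simp
  map_mem q hq := by
    simp only [mem_insert, mem_singleton] at hq ⊢
    rcases hq with rfl | rfl | rfl <;> simp [hτ]
  edge := by simp
  subset := by simp
  reach q hq := by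
    have h0 : ReflTransGen (fun a b => b = τ a ∨ a ∈ (∅ : Finset Q) ∧ b = σ a) q₀ q₀ := .refl
    simp only [mem_insert, mem_singleton] at hq
    rcases hq with rfl | rfl | rfl
    · exact h0
    · exact h0.tail (.inl rfl)
    · exact (h0.tail (.inl rfl)).tail (.inl rfl)
  card := by rw [card_orbit_three hτ]; simp

/-- An edge leaving `R` ends in an orbit disjoint from `R`, because `R` is a union of orbits of `τ`.
Adding the orbit and both ends of the edge adds `6` to each side of `card`. -/
theorem IsPartialTree.extend {q₀ : Q} {R E : Finset Q} (h : IsPartialTree σ τ q₀ R E)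
    (hσ : ∀ q, σ (σ q) = q) (hτ : ∀ q, τ (τ (τ q)) = q) {q : Q} (hq : q ∈ R) (hq' : σ q ∉ R) :
    IsPartialTree σ τ q₀ (R ∪ {σ q, τ (σ q), τ (τ (σ q))}) (E ∪ {q, σ q}) := by
  have hinv : ∀ x, τ x ∈ R → x ∈ R := fun x hx => hτ x ▸ h.map_mem _ (h.map_mem _ hx)
  have hne : σ q ≠ q := fun h' => hq' (h'.symm ▸ hq)
  have hdisj : Disjoint R {σ q, τ (σ q), τ (τ (σ q))} := by
    rw [disjoint_right]
    intro x hx hxR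
    simp only [mem_insert, mem_singleton] at hx
    rcases hx with rfl | rfl | rfl
    · exact hq' hxR
    · exact hq' (hinv _ hxR)
    · exact hq' (hinv _ (hinv _ hxR))
  have hmono : ∀ x, ReflTransGen (fun a b => b = τ a ∨ a ∈ E ∧ b = σ a) q₀ x →
      ReflTransGen (fun a b => b = τ a ∨ a ∈ E ∪ {q, σ q} ∧ b = σ a) q₀ x := fun x hx =>
    hx.lift id fun a b hab => hab.imp id (And.imp_left (mem_union_left _))
  refine ⟨mem_union_left _ h.base, ?_, ?_, ?_, ?_, ?_⟩
  · intro x hx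
    simp only [mem_union, mem_insert, mem_singleton] at hx ⊢
    rcases hx with hx | rfl | rfl | rfl
    · exact .inl (h.map_mem _ hx)
    all_goals simp [hτ]
  · intro x hx
    simp only [mem_union, mem_insert, mem_singleton] at hx ⊢
    rcases hx with hx | rfl | rfl
    · exact ⟨.inl (h.edge x hx).1, (h.edge x hx).2⟩
    · exact ⟨by simp, hne⟩
    · exact ⟨by simp [hσ], by rw [hσ]; exact hne.symm⟩
  · intro x hx
    simp only [mem_union, mem_insert, mem_singleton] at hx ⊢
    rcases hx with hx | rfl | rfl
    · exact .inl (h.subset hx)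
    · exact .inl hq
    · simp
  · intro x hx
    have h0 : ReflTransGen (fun a b => b = τ a ∨ a ∈ E ∪ {q, σ q} ∧ b = σ a) q₀ (σ q) :=
      (hmono q (h.reach q hq)).tail (.inr ⟨by simp, rfl⟩)
    simp only [mem_union, mem_insert, mem_singleton] at hx
    rcases hx with hx | rfl | rfl | rfl
    · exact hmono x (h.reach x hx)
    · exact h0
    · exact h0.tail (.inl rfl)
    · exact (h0.tail (.inl rfl)).tail (.inl rfl)
  · have hE : Disjoint E {q, σ q} := by
      rw [disjoint_right]
      intro x hx hxE
      simp only [mem_insert, mem_singleton] at hx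
      rcases hx with rfl | rfl
      · exact hq' (h.subset (h.edge _ hxE).1)
      · exact hq' (h.subset hxE)
    rw [filter_union, card_union_of_disjoint hdisj, card_union_of_disjoint hE,
      card_union_of_disjoint (disjoint_filter_filter hdisj), card_pair hne.symm]
    have := card_orbit_three hτ (σ q)
    have := h.card
    omega

/-- A connected graph has a spanning tree. -/
theorem exists_isPartialTree_univ [Fintype Q] (hσ : ∀ q, σ (σ q) = q) (hτ : ∀ q, τ (τ (τ q)) = q) (q₀ : Q)
    (htrans : ∀ R : Set Q, q₀ ∈ R → (∀ q ∈ R, σ q ∈ R) → (∀ q ∈ R, τ q ∈ R) → R = Set.univ) :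
    ∃ E : Finset Q, IsPartialTree σ τ q₀ univ E := by
  classical
  obtain ⟨⟨R, E⟩, hp, hmax⟩ := exists_max_image
    (univ.filter fun p : Finset Q × Finset Q => IsPartialTree σ τ q₀ p.1 p.2) (fun p => #p.1)
    ⟨(_, _), mem_filter.mpr ⟨mem_univ _, .singleton hτ q₀⟩⟩
  have h : IsPartialTree σ τ q₀ R E := (mem_filter.mp hp).2
  suffices R = univ from ⟨E, this ▸ h⟩
  rw [← coe_eq_univ]
  -- A maximal tree is closed under `σ`, since otherwise it could be extended; transitivity then
  -- makes it everything.
  refine htrans _ h.base (fun q hq => ?_) h.map_mem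
  by_contra hq'
  have h1 := hmax (_, _) (mem_filter.mpr ⟨mem_univ _, h.extend hσ hτ hq hq'⟩)
  have h2 : #R < #(R ∪ {σ q, τ (σ q), τ (τ (σ q))}) :=
    card_lt_card (ssubset_iff_of_subset subset_union_left |>.mpr ⟨σ q, by simp, hq'⟩)
  exact absurd h1 (not_le.mpr h2)

variable (σ τ) in
/-- Labels in a group `M` for the edges `q → σ q` and `q → τ q`, trivial on the tree `E` and on
the orbits of `τ` of size three. -/
structure TreeLabelling (E : Finset Q) (M : Type*) [Group M] where
  e : Q → M
  f : Q → M
  e_mul : ∀ q, e (σ q) * e q = 1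
  e_tree : ∀ q ∈ E, e q = 1
  f_cube : ∀ q, f q ^ 3 = 1
  f_free : ∀ q, τ q ≠ q → f q = 1

variable {E : Finset Q}

/-- This is what makes `t ^ 3 = 1` survive when the action on `Q` is twisted by the labels. -/
theorem TreeLabelling.f_mul {M : Type*} [Group M] (L : TreeLabelling σ τ E M) (q : Q) :
    L.f (τ (τ q)) * (L.f (τ q) * L.f q) = 1 := by
  by_cases h : τ q = q
  · rw [h, h, ← pow_three]; exact L.f_cube q
  · have h1 : τ (τ q) ≠ τ q := fun h' => h (τ.injective h')
    have h2 : τ (τ (τ q)) ≠ τ (τ q) := fun h' => h1 (τ.injective h')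
    rw [L.f_free _ h, L.f_free _ h1, L.f_free _ h2]; simp

/-- Two labellings with disjoint supports combine to one in the free product. -/
def TreeLabelling.combine {M N : Type*} [Group M] [Group N] (L : TreeLabelling σ τ E M)
    (L' : TreeLabelling σ τ E N) (he : ∀ q, L.e q = 1 ∨ L'.e q = 1)
    (hf : ∀ q, L.f q = 1 ∨ L'.f q = 1) : TreeLabelling σ τ E (Monoid.Coprod M N) where
  e q := Monoid.Coprod.inl (L.e q) * Monoid.Coprod.inr (L'.e q)
  f q := Monoid.Coprod.inl (L.f q) * Monoid.Coprod.inr (L'.f q)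
  e_mul q := by
    have h := L.e_mul q
    have h' := L'.e_mul q
    rcases he q with hq | hq
    · rw [hq, mul_one] at h
      rw [hq, h, map_one, one_mul, one_mul, ← map_mul, h', map_one]
    · rw [hq, mul_one] at h'
      rw [hq, h', map_one, mul_one, mul_one, ← map_mul, h, map_one]
  e_tree q hq := by rw [L.e_tree q hq, L'.e_tree q hq]; simp
  f_cube q := by
    rcases hf q with hq | hq
    · rw [hq, map_one, one_mul, ← map_pow, L'.f_cube, map_one]
    · rw [hq, map_one, mul_one, ← map_pow, L.f_cube, map_one]
  f_free q hq := by rw [L.f_free q hq, L'.f_free q hq]; simp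

/-- The labelling supported on a fixed point of `τ`. -/
def TreeLabelling.ofFixed (σ : Equiv.Perm Q) (E : Finset Q) {q₁ : Q} (h : τ q₁ = q₁) :
    TreeLabelling σ τ E (Multiplicative (ZMod 3)) where
  e _ := 1
  f q := if q = q₁ then Multiplicative.ofAdd 1 else 1
  e_mul _ := by simp
  e_tree _ _ := rfl
  f_cube q := by split_ifs <;> decide
  f_free q hq := if_neg (by rintro rfl; exact hq h)

/-- The labelling supported on an edge outside the tree. -/
def TreeLabelling.ofEdge (τ : Equiv.Perm Q) (hσ : ∀ q, σ (σ q) = q)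
    (hE : ∀ q ∈ E, σ q ∈ E) {q₁ : Q} (h : q₁ ∉ E) :
    TreeLabelling σ τ E (Multiplicative (ZMod 2)) where
  e q := if q = q₁ ∨ q = σ q₁ then Multiplicative.ofAdd 1 else 1
  f _ := 1
  -- Both ends carry the same element of order two, so this also holds when `σ` fixes `q₁`.
  e_mul q := by
    have : (σ q = q₁ ∨ σ q = σ q₁) ↔ (q = q₁ ∨ q = σ q₁) := by
      rw [σ.injective.eq_iff, or_comm, ← σ.injective.eq_iff (a := q) (b := σ q₁), hσ]
    simp only [this]
    split_ifs <;> decide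
  e_tree q hq := if_neg (by
    rintro (rfl | rfl)
    · exact h hq
    · exact h (hσ q₁ ▸ hE _ hq))
  f_cube _ := by simp
  f_free _ _ := rfl

/-- The labels generate the group. -/
def TreeLabelling.Generates {M : Type*} [Group M] (L : TreeLabelling σ τ E M) : Prop :=
  ∀ S : Subgroup M, (∀ q, L.e q ∈ S) → (∀ q, L.f q ∈ S) → S = ⊤

theorem TreeLabelling.generates_ofFixed {q₁ : Q} (h : τ q₁ = q₁) :
    (TreeLabelling.ofFixed σ E h).Generates := by
  intro S _ hf
  rw [Subgroup.eq_top_iff']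
  intro m
  have : m = (Multiplicative.ofAdd (1 : ZMod 3)) ^ (Multiplicative.toAdd m).val := by
    revert m; decide
  rw [this]
  exact pow_mem (by simpa [TreeLabelling.ofFixed] using hf q₁) _

theorem TreeLabelling.generates_ofEdge (hσ : ∀ q, σ (σ q) = q)
    (hE : ∀ q ∈ E, σ q ∈ E) {q₁ : Q} (h : q₁ ∉ E) :
    (TreeLabelling.ofEdge τ hσ hE h).Generates := by
  intro S he _
  rw [Subgroup.eq_top_iff']
  intro m
  have : m = (Multiplicative.ofAdd (1 : ZMod 2)) ^ (Multiplicative.toAdd m).val := by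
    revert m; decide
  rw [this]
  exact pow_mem (by simpa [TreeLabelling.ofEdge] using he q₁) _

-- Because the supports are disjoint, every non-trivial label of either factor occurs on its own as
-- a label of the combination.
set_option linter.unusedSectionVars false in
theorem TreeLabelling.Generates.combine {M N : Type*} [Group M] [Group N]
    {L : TreeLabelling σ τ E M} {L' : TreeLabelling σ τ E N} (hL : L.Generates)
    (hL' : L'.Generates) (he : ∀ q, L.e q = 1 ∨ L'.e q = 1)
    (hf : ∀ q, L.f q = 1 ∨ L'.f q = 1) : (L.combine L' he hf).Generates := by
  intro S hSe hSf
  have h1 : S.comap Monoid.Coprod.inl = ⊤ := by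
    refine hL _ (fun q => ?_) fun q => ?_
    · rcases he q with h | h
      · rw [h]; exact one_mem _
      · simpa [TreeLabelling.combine, h] using hSe q
    · rcases hf q with h | h
      · rw [h]; exact one_mem _
      · simpa [TreeLabelling.combine, h] using hSf q
  have h2 : S.comap Monoid.Coprod.inr = ⊤ := by
    refine hL' _ (fun q => ?_) fun q => ?_
    · rcases he q with h | h
      · simpa [TreeLabelling.combine, h] using hSe q
      · rw [h]; exact one_mem _
    · rcases hf q with h | h
      · simpa [TreeLabelling.combine, h] using hSf q
      · rw [h]; exact one_mem _
  rw [eq_top_iff, ← Monoid.Coprod.range_inl_sup_range_inr, sup_le_iff]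
  constructor
  · rintro _ ⟨m, rfl⟩
    exact (h1.symm ▸ Subgroup.mem_top m : m ∈ S.comap Monoid.Coprod.inl)
  · rintro _ ⟨m, rfl⟩
    exact (h2.symm ▸ Subgroup.mem_top m : m ∈ S.comap Monoid.Coprod.inr)

/-- A spanning tree leaves room for two independent labels. -/
theorem IsPartialTree.exists_generates [Fintype Q] {q₀ : Q} (h : IsPartialTree σ τ q₀ univ E)
    (hσ : ∀ q, σ (σ q) = q) :
    ∃ (M N : Type) (_ : Group M) (_ : Group N) (_ : Nontrivial M) (_ : Nontrivial N)
      (L : TreeLabelling σ τ E (Monoid.Coprod M N)), L.Generates := by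
  have hE := fun q hq => (h.edge q hq).1
  have hcard := h.card
  have hcompl : #Eᶜ + #E = #(univ : Finset Q) := by rw [add_comm, card_add_card_compl, card_univ]
  -- With `f` fixed points of `τ`, `card` gives `3 * #Eᶜ = #Q + 6 - 4 * f`. So `Eᶜ` is non-empty if
  -- `f = 1`, and has more than two elements, hence two different edges, if `f = 0`.
  by_cases hb2 : 1 < #{q | τ q = q}
  · obtain ⟨q₁, h₁, q₂, h₂, hne⟩ := one_lt_card.mp hb2
    refine ⟨_, _, inferInstance, inferInstance, inferInstance, inferInstance, _,
      (TreeLabelling.generates_ofFixed (mem_filter.mp h₁).2).combine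
        (TreeLabelling.generates_ofFixed (mem_filter.mp h₂).2) (fun q => .inl rfl) fun q => ?_⟩
    by_cases hq : q = q₁
    · exact .inr (if_neg (hq ▸ hne))
    · exact .inl (if_neg hq)
  by_cases hb1 : 0 < #{q | τ q = q}
  · obtain ⟨q₁, h₁⟩ := card_pos.mp hb1
    obtain ⟨q₂, h₂⟩ : Eᶜ.Nonempty := by rw [← card_pos]; omega
    exact ⟨_, _, inferInstance, inferInstance, inferInstance, inferInstance, _,
      (TreeLabelling.generates_ofFixed (mem_filter.mp h₁).2).combine
        (TreeLabelling.generates_ofEdge hσ hE (mem_compl.mp h₂)) (fun q => .inl rfl)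
        fun q => .inr rfl⟩
  · obtain ⟨q₁, h₁⟩ : Eᶜ.Nonempty := by rw [← card_pos]; omega
    obtain ⟨q₂, h₂, hne, hne'⟩ : ∃ q₂ ∈ Eᶜ, q₂ ≠ q₁ ∧ q₂ ≠ σ q₁ := by
      by_contra! hcon
      have hsub : Eᶜ ⊆ {q₁, σ q₁} := fun q hq => by
        rw [mem_insert, mem_singleton]
        exact or_iff_not_imp_left.mpr (hcon q hq)
      have := (card_le_card hsub).trans card_le_two
      omega
    refine ⟨_, _, inferInstance, inferInstance, inferInstance, inferInstance, _,
      (TreeLabelling.generates_ofEdge hσ hE (mem_compl.mp h₁)).combine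
        (TreeLabelling.generates_ofEdge hσ hE (mem_compl.mp h₂)) (fun q => ?_) fun q => .inl rfl⟩
    by_cases hq : q = q₁ ∨ q = σ q₁
    · refine .inr (if_neg ?_)
      rintro (rfl | rfl)
      · tauto
      · rcases hq with hq | hq
        · exact hne' (by rw [← hq, hσ])
        · exact hne (σ.injective hq)
    · exact .inl (if_neg hq)

end Combinatorics

/-! ### Cocycles over a permutation action -/

section Subgroups

variable {F Q : Type*} [Group F] [MulAction F Q] {X : Type*} [Group X]

/-- A homomorphism from `F` to the permutations of `Q × X` that lifts the action on `Q` and commutes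
with the right multiplication on `X`. -/
structure IsCocycleAction (A : F →* Equiv.Perm (Q × X)) : Prop where
  fst : ∀ g p, (A g p).1 = g • p.1
  mul : ∀ g p y, A g (p.1, p.2 * y) = ((A g p).1, (A g p).2 * y)

/-- Both properties pass to products and inverses, so the explicit form is needed on generators
only. -/
theorem IsCocycleAction.of_closure (A : F →* Equiv.Perm (Q × X)) {T : Set F}
    (hT : Subgroup.closure T = ⊤)
    (h : ∀ g ∈ T, ∃ c : Q → X, ∀ p, A g p = (g • p.1, c p.1 * p.2)) : IsCocycleAction A := by
  have key : ∀ g : F, (∀ p, (A g p).1 = g • p.1) ∧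
      ∀ p y, A g (p.1, p.2 * y) = ((A g p).1, (A g p).2 * y) := by
    intro g
    have hg : g ∈ Subgroup.closure T := hT ▸ Subgroup.mem_top g
    induction hg using Subgroup.closure_induction with
    | mem g hg =>
      obtain ⟨c, hc⟩ := h g hg
      exact ⟨fun p => by rw [hc], fun p y => by simp [hc, mul_assoc]⟩
    | one => simp
    | mul g g' _ _ hg hg' =>
      refine ⟨fun p => ?_, fun p y => ?_⟩
      · rw [map_mul, Equiv.Perm.mul_apply, hg.1, hg'.1, mul_smul]
      · rw [map_mul, Equiv.Perm.mul_apply, Equiv.Perm.mul_apply, hg'.2, hg.2]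
    | inv g _ hg =>
      refine ⟨fun p => ?_, fun p y => ?_⟩
      · rw [eq_inv_smul_iff, ← hg.1, ← Equiv.Perm.mul_apply, ← map_mul]
        simp
      · apply (A g).injective
        rw [hg.2, ← Equiv.Perm.mul_apply, ← Equiv.Perm.mul_apply, ← map_mul]
        simp
  exact ⟨fun g => (key g).1, fun g => (key g).2⟩

namespace IsCocycleAction

variable {A : F →* Equiv.Perm (Q × X)} (hA : IsCocycleAction A) (K : Subgroup F) {q₀ : Q}
  (hK : ∀ k ∈ K, k • q₀ = q₀)

include hA in
theorem apply_mk (g : F) (q : Q) (x : X) : A g (q, x) = (g • q, (A g (q, 1)).2 * x) := by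
  have := hA.mul g (q, 1) x
  rwa [one_mul, hA.fst] at this

/-- The homomorphism to `X` obtained by restricting a cocycle to a subgroup of a stabilizer. -/
def toHom : K →* X :=
  MonoidHom.mk' (fun k => (A k (q₀, 1)).2) fun k k' => by
    rw [Subgroup.coe_mul, map_mul, Equiv.Perm.mul_apply, hA.apply_mk k' q₀ 1, hK _ k'.2, mul_one,
      hA.apply_mk k]

theorem toHom_apply (k : K) : hA.toHom K hK k = (A k (q₀, 1)).2 := rfl

end IsCocycleAction

end Subgroups

open FreeProductTwoThree in
/-- A finite-index subgroup of `C₂ * C₃` maps onto a free product of two non-trivial groups. -/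
theorem FreeProductTwoThree.exists_surjective_of_finiteIndex (K : Subgroup FreeProductTwoThree)
    [K.FiniteIndex] :
    ∃ (M N : Type) (_ : Group M) (_ : Group N) (_ : Nontrivial M) (_ : Nontrivial N)
      (φ : K →* Monoid.Coprod M N), Function.Surjective φ := by
  classical
  let Q := FreeProductTwoThree ⧸ K
  have : Fintype Q := K.fintypeQuotientOfFiniteIndex
  let σ : Equiv.Perm Q := MulAction.toPerm s
  let τ : Equiv.Perm Q := MulAction.toPerm t
  let q₀ : Q := ((1 : FreeProductTwoThree) : FreeProductTwoThree ⧸ K)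
  have hσ : ∀ q, σ (σ q) = q := fun q => by
    change s • s • q = q
    rw [← mul_smul, ← pow_two, s_sq, one_smul]
  have hτ : ∀ q, τ (τ (τ q)) = q := fun q => by
    change t • t • t • q = q
    rw [← mul_smul, ← mul_smul, ← pow_three', t_cube, one_smul]
  have hK : ∀ k ∈ K, k • q₀ = q₀ := fun k hk => by
    have : k ∈ MulAction.stabilizer FreeProductTwoThree q₀ := by
      rwa [MulAction.stabilizer_quotient]
    exact this
  have hK' : ∀ k, k • q₀ = q₀ → k ∈ K := fun k hk => by
    have : k ∈ MulAction.stabilizer FreeProductTwoThree q₀ := hk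
    rwa [MulAction.stabilizer_quotient] at this
  have htrans : ∀ R : Set Q, q₀ ∈ R → (∀ q ∈ R, σ q ∈ R) → (∀ q ∈ R, τ q ∈ R) →
      R = Set.univ := by
    intro R h0 hs ht
    have key : ∀ g : FreeProductTwoThree, ∀ q, q ∈ R ↔ g • q ∈ R := by
      intro g
      have hg : g ∈ Subgroup.closure {s, t} := closure_eq_top ▸ Subgroup.mem_top g
      induction hg using Subgroup.closure_induction with
      | mem g hg =>
        rcases hg with rfl | rfl
        · exact fun q => ⟨hs q, fun h => hσ q ▸ hs _ h⟩
        · exact fun q => ⟨ht q, fun h => hτ q ▸ ht _ (ht _ h)⟩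
      | one => simp
      | mul g g' _ _ hg hg' => intro q; rw [hg' q, hg, mul_smul]
      | inv g _ hg => intro q; rw [hg (g⁻¹ • q), smul_inv_smul]
    rw [Set.eq_univ_iff_forall]
    intro q
    obtain ⟨g, rfl⟩ := MulAction.exists_smul_eq FreeProductTwoThree q₀ q
    exact (key g q₀).mp h0
  obtain ⟨E, hE⟩ := exists_isPartialTree_univ hσ hτ q₀ htrans
  obtain ⟨M, N, _, _, _, _, L, hL⟩ := hE.exists_generates hσ
  refine ⟨M, N, inferInstance, inferInstance, inferInstance, inferInstance, ?_⟩
  -- The action on cosets is twisted by the labels; `e_mul` and `f_mul` give the relations of `C₂ *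
  -- C₃`.
  let a : Equiv.Perm (Q × Monoid.Coprod M N) := Equiv.prodShear σ fun q => Equiv.mulLeft (L.e q)
  let b : Equiv.Perm (Q × Monoid.Coprod M N) := Equiv.prodShear τ fun q => Equiv.mulLeft (L.f q)
  have ha' : ∀ p, a p = (σ p.1, L.e p.1 * p.2) := fun _ => rfl
  have hb' : ∀ p, b p = (τ p.1, L.f p.1 * p.2) := fun _ => rfl
  have ha : a ^ 2 = 1 := by
    ext1 p
    rw [pow_two, Equiv.Perm.mul_apply, ha', ha', ← mul_assoc, L.e_mul, hσ]
    simp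
  have hb : b ^ 3 = 1 := by
    ext1 p
    rw [pow_three, Equiv.Perm.mul_apply, Equiv.Perm.mul_apply, hb', hb', hb', ← mul_assoc,
      ← mul_assoc, mul_assoc (L.f _), L.f_mul, hτ]
    simp
  obtain ⟨A, hAs, hAt⟩ := exists_hom a b ha hb
  have hA : IsCocycleAction A := by
    refine .of_closure A closure_eq_top ?_
    rintro _ (rfl | rfl)
    · exact ⟨L.e, fun p => by rw [hAs]; rfl⟩
    · exact ⟨L.f, fun p => by rw [hAt]; rfl⟩
  -- Tree edges and steps in orbits of size three have trivial label; a step at a fixed point of `τ`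
  -- is skipped.
  have hreach : ∀ q, ∃ g, A g (q₀, 1) = (q, 1) := by
    intro q
    induction hE.reach q (Finset.mem_univ _) with
    | refl => exact ⟨1, by simp⟩
    | tail _ h ih =>
      rename_i x y _
      obtain ⟨g, hg⟩ := ih
      rcases h with rfl | ⟨hx, rfl⟩
      · by_cases hx : τ x = x
        · exact ⟨g, hx.symm ▸ hg⟩
        · exact ⟨t * g, by rw [map_mul, Equiv.Perm.mul_apply, hg, hAt, hb', L.f_free x hx, one_mul]⟩
      · exact ⟨s * g, by rw [map_mul, Equiv.Perm.mul_apply, hg, hAs, ha', L.e_tree x hx, one_mul]⟩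
  -- Paths of trivial label from `q₀` to `q` and from `g • q` back close the step up to an element
  -- of `K` with value `x`.
  have hmem : ∀ g q x, A g (q, 1) = (g • q, x) → x ∈ (hA.toHom K hK).range := by
    intro g q x hx
    obtain ⟨r, hr⟩ := hreach q
    obtain ⟨r', hr'⟩ := hreach (g • q)
    have hr'' : A r'⁻¹ (g • q, 1) = (q₀, 1) := by
      rw [← hr', ← Equiv.Perm.mul_apply, ← map_mul]; simp
    have hk : A (r'⁻¹ * g * r) (q₀, 1) = (q₀, x) := by
      rw [map_mul, map_mul, Equiv.Perm.mul_apply, Equiv.Perm.mul_apply, hr, hx]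
      have := hA.mul r'⁻¹ (g • q, 1) x
      rwa [one_mul, hr'', one_mul] at this
    refine ⟨⟨r'⁻¹ * g * r, hK' _ ?_⟩, ?_⟩
    · rw [← hA.fst _ (q₀, 1), hk]
    · rw [hA.toHom_apply]
      exact congrArg Prod.snd hk
  refine ⟨hA.toHom K hK, MonoidHom.range_eq_top.mp (hL _ (fun q => ?_) fun q => ?_)⟩
  · exact hmem s q _ (by rw [hAs, ha', mul_one]; rfl)
  · exact hmem t q _ (by rw [hAt, hb', mul_one]; rfl)

/-! ### The reduced norm on a component isomorphic to `M₂(ℚ)` -/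

section ReducedNormMatrix

variable {D : Type u} [DivisionRing D] [Algebra ℚ D] {n : ℕ} [NeZero n]

/-- The inclusion of `ℚ` into the centre of a division `ℚ`-algebra. -/
def ratToCenter (D : Type u) [DivisionRing D] [Algebra ℚ D] : ℚ →+* Subring.center D :=
  (algebraMap ℚ D).codRestrict (Subring.center D) fun q => Set.algebraMap_mem_center q

/-- Scalars from the centre of `D` are central matrices, and `ψ` sends these into the centre `ℚ` of
`M₂(ℚ)`. This avoids proving `n = 2` and `D = ℚ`. -/
theorem ratToCenter_bijective
    (ψ : Matrix (Fin n) (Fin n) D ≃ₐ[ℚ] Matrix (Fin 2) (Fin 2) ℚ) :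
    Function.Bijective (ratToCenter D) := by
  refine ⟨(ratToCenter D).injective, fun k => ?_⟩
  have hk : ψ (algebraMap (Subring.center D) _ k) ∈
      Subalgebra.center ℚ (Matrix (Fin 2) (Fin 2) ℚ) := by
    rw [Subalgebra.mem_center_iff]
    intro b
    obtain ⟨b, rfl⟩ := ψ.surjective b
    rw [← map_mul, ← map_mul, Algebra.commutes]
  obtain ⟨q, hq⟩ := (Algebra.IsCentral.mem_center_iff ℚ).mp hk
  refine ⟨q, Subtype.ext ?_⟩
  rw [← ψ.commutes] at hq
  have h := congrFun₂ (ψ.injective hq) 0 0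
  rw [Matrix.algebraMap_matrix_apply, Matrix.algebraMap_matrix_apply, if_pos rfl, if_pos rfl] at h
  exact h.symm

/-- Extending the scalars of a matrix algebra. -/
noncomputable def tensorMatrixEquiv (K E : Type*) [Field K] [Field E] [Algebra K E] :
    E ⊗[K] Matrix (Fin 2) (Fin 2) K ≃ₐ[E] Matrix (Fin 2) (Fin 2) E :=
  AlgEquiv.ofRingEquiv (f := (matrixEquivTensor (Fin 2) K E).symm.toRingEquiv) fun e => by
    change (matrixEquivTensor (Fin 2) K E).symm (e ⊗ₜ 1) = _
    rw [matrixEquivTensor_apply_symm]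
    ext i j
    simp [Matrix.algebraMap_matrix_apply, Matrix.one_apply]

theorem tensorMatrixEquiv_one_tmul (K E : Type*) [Field K] [Field E] [Algebra K E]
    (x : Matrix (Fin 2) (Fin 2) K) :
    tensorMatrixEquiv K E (1 ⊗ₜ x) = x.map (algebraMap K E) := by
  change (matrixEquivTensor (Fin 2) K E).symm (1 ⊗ₜ x) = _
  rw [matrixEquivTensor_apply_symm]
  simp

variable [FiniteDimensional ℚ D]

/-- By independence of the splitting, the norm may be computed in the one that `ψ` induces after
identifying `ℚ` with the centre of `D`. -/
theorem reducedNorm_eq_det (ψ : Matrix (Fin n) (Fin n) D ≃ₐ[ℚ] Matrix (Fin 2) (Fin 2) ℚ)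
    (x : Matrix (Fin n) (Fin n) D) :
    reducedNorm (Subring.center D) (Matrix (Fin n) (Fin n) D) x =
      ((algebraMap (Subring.center D) (AlgebraicClosure (Subring.center D))).comp
        (ratToCenter D)) (ψ x).det := by
  let r : ℚ ≃+* Subring.center D := RingEquiv.ofBijective _ (ratToCenter_bijective ψ)
  let e : Matrix (Fin n) (Fin n) D ≃ₐ[Subring.center D]
      Matrix (Fin 2) (Fin 2) (Subring.center D) :=
    AlgEquiv.ofRingEquiv (f := ψ.toRingEquiv.trans r.mapMatrix) fun k => by
      obtain ⟨q, rfl⟩ := r.surjective k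
      have : algebraMap (Subring.center D) (Matrix (Fin n) (Fin n) D) (r q) =
          algebraMap ℚ _ q := by
        ext i j
        rw [Matrix.algebraMap_matrix_apply, Matrix.algebraMap_matrix_apply]
        rfl
      rw [this]
      change r.mapMatrix (ψ (algebraMap ℚ _ q)) = _
      rw [ψ.commutes]
      ext i j
      by_cases h : i = j <;> simp [Matrix.algebraMap_matrix_apply, h]
  let S : Splitting (Subring.center D) (Matrix (Fin n) (Fin n) D) :=
    { n := 2
      equiv := (Algebra.TensorProduct.congr AlgEquiv.refl e).trans (tensorMatrixEquiv _ _) }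
  rw [reducedNorm_eq _ _ S]
  change (tensorMatrixEquiv (Subring.center D) (AlgebraicClosure (Subring.center D))
    (Algebra.TensorProduct.congr AlgEquiv.refl e (1 ⊗ₜ x))).det = _
  rw [Algebra.TensorProduct.congr_apply, Algebra.TensorProduct.map_tmul]
  change (tensorMatrixEquiv (Subring.center D) (AlgebraicClosure (Subring.center D)) (1 ⊗ₜ r.mapMatrix (ψ x))).det = _
  rw [tensorMatrixEquiv_one_tmul, RingHom.map_det]
  rfl

theorem reducedNorm_eq_one_iff
    (ψ : Matrix (Fin n) (Fin n) D ≃ₐ[ℚ] Matrix (Fin 2) (Fin 2) ℚ)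
    (x : Matrix (Fin n) (Fin n) D) :
    reducedNorm (Subring.center D) (Matrix (Fin n) (Fin n) D) x = 1 ↔ (ψ x).det = 1 := by
  rw [reducedNorm_eq_det ψ, map_eq_one_iff _ (RingHom.injective _)]

end ReducedNormMatrix

/-! ### Orders in `M₂(ℚ)` -/

/-- A subring of `M₂(ℚ)` that is finitely generated as an abelian group is conjugate to a subring
of `M₂(ℤ)`. -/
theorem exists_algEquiv_forall_integral (Λ : Subring (Matrix (Fin 2) (Fin 2) ℚ))
    (hΛ : Λ.toAddSubgroup.FG) :
    ∃ θ : Matrix (Fin 2) (Fin 2) ℚ ≃ₐ[ℚ] Matrix (Fin 2) (Fin 2) ℚ,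
      ∀ x ∈ Λ, ∃ y : Matrix (Fin 2) (Fin 2) ℤ, θ x = y.map (Int.castRingHom ℚ) := by
  let M : Submodule ℤ (Matrix (Fin 2) (Fin 2) ℚ) := AddSubgroup.toIntSubmodule Λ.toAddSubgroup
  have hM : M.FG := by rw [Submodule.fg_iff_addSubgroup_fg]; exact hΛ
  let ev (j : Fin 2) : Matrix (Fin 2) (Fin 2) ℚ →ₗ[ℤ] (Fin 2 → ℚ) :=
    { toFun := fun x i => x i j
      map_add' := fun _ _ => rfl
      map_smul' := fun _ _ => rfl }
  -- The columns of elements of `Λ` span the lattice `Λ · ℤ²`. It is `Λ`-stable, and it spans `ℚ²`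
  -- because `1 ∈ Λ`; in a `ℤ`-basis of it, `Λ` acts by integral matrices.
  let L : Submodule ℤ (Fin 2 → ℚ) := ⨆ j, M.map (ev j)
  have hL : ∀ j, ∀ x ∈ Λ, ev j x ∈ L := fun j x hx =>
    (le_iSup (fun j => M.map (ev j)) j) ⟨x, hx, rfl⟩
  have hstab : ∀ x ∈ Λ, ∀ v ∈ L, x.mulVec v ∈ L := by
    intro x hx v hv
    have : L ≤ L.comap ((Matrix.mulVecLin x).restrictScalars ℤ) := by
      refine iSup_le fun j => ?_
      rintro _ ⟨y, hy, rfl⟩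
      have := hL j (x * y) (Λ.mul_mem hx hy)
      exact this
    exact this hv
  have hlat : Submodule.IsLattice ℚ L := by
    refine ⟨Submodule.fg_iSup _ fun j => hM.map _, ?_⟩
    rw [eq_top_iff, ← (Pi.basisFun ℚ (Fin 2)).span_eq, Submodule.span_le]
    rintro _ ⟨j, rfl⟩
    refine Submodule.subset_span ?_
    have : ev j 1 = Pi.basisFun ℚ (Fin 2) j := by
      ext i
      change (1 : Matrix (Fin 2) (Fin 2) ℚ) i j = _
      simp [Matrix.one_apply, Pi.single_apply]
    exact this ▸ hL j 1 Λ.one_mem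
  have hfr : Module.finrank ℤ L = 2 := by
    rw [Submodule.IsLattice.finrank_of_pi ℚ L, Fintype.card_fin]
  have : Module.Free ℤ L := Submodule.IsLattice.free ℚ L
  have : Module.Finite ℤ L := Submodule.IsLattice.finite ℚ L
  let b := Module.finBasisOfFinrankEq ℤ L hfr
  let β : Module.Basis (Fin 2) ℚ (Fin 2 → ℚ) := b.extendOfIsLattice ℚ
  refine ⟨Matrix.toLinAlgEquiv'.trans (LinearMap.toMatrixAlgEquiv β), fun x hx => ?_⟩
  refine ⟨Matrix.of fun i j => b.repr ⟨x.mulVec (b j), hstab x hx _ (b j).2⟩ i, ?_⟩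
  ext i j
  rw [AlgEquiv.trans_apply, LinearMap.toMatrixAlgEquiv_apply, Matrix.toLinAlgEquiv'_apply,
    Module.Basis.extendOfIsLattice_apply]
  set w : L := ⟨x.mulVec (b j), hstab x hx _ (b j).2⟩ with hw
  have hsum : x.mulVec (b j : Fin 2 → ℚ) = ∑ k, (b.repr w k : ℚ) • β k := by
    have h := congrArg Subtype.val (b.sum_repr w)
    rw [AddSubmonoidClass.coe_finsetSum] at h
    rw [show x.mulVec (b j : Fin 2 → ℚ) = (w : Fin 2 → ℚ) from rfl, ← h]
    refine Finset.sum_congr rfl fun k _ => ?_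
    rw [Module.Basis.extendOfIsLattice_apply, Int.cast_smul_eq_zsmul]
    rfl
  rw [hsum, β.repr_sum_self]
  rfl

/-! ### The image of `SL₁(O)` in `SL₂(ℤ)` -/

theorem IsOrderIn.exists_nsmul_mem {A : Type*} [Ring A] [Algebra ℚ A] {O : Subring A}
    (hO : IsOrderIn O) (a : A) : ∃ k : ℕ, k ≠ 0 ∧ k • a ∈ O := by
  have ha : a ∈ Submodule.span ℚ (O : Set A) := hO.span_eq_top ▸ Submodule.mem_top
  induction ha using Submodule.span_induction with
  | mem x hx => exact ⟨1, one_ne_zero, by simpa using hx⟩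
  | zero => exact ⟨1, one_ne_zero, by simp⟩
  | add x y _ _ hx hy =>
    obtain ⟨k, hk, hx⟩ := hx
    obtain ⟨l, hl, hy⟩ := hy
    refine ⟨k * l, mul_ne_zero hk hl, ?_⟩
    rw [smul_add]
    refine O.add_mem ?_ ?_
    · rw [mul_comm, mul_smul]; exact O.nsmul_mem hx l
    · rw [mul_smul]; exact O.nsmul_mem hy k
  | smul q x _ hx =>
    obtain ⟨k, hk, hx⟩ := hx
    refine ⟨q.den * k, mul_ne_zero q.den_ne_zero hk, ?_⟩
    have : (q.den * k) • q • x = q.num • k • x := by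
      rw [← Nat.cast_smul_eq_nsmul ℚ (q.den * k), ← Nat.cast_smul_eq_nsmul ℚ k,
        ← Int.cast_smul_eq_zsmul ℚ, smul_smul, smul_smul]
      congr 1
      push_cast
      rw [mul_right_comm, mul_comm (q.den : ℚ), Rat.mul_den_eq_num]
    rw [this]
    exact O.zsmul_mem hx _

theorem IsOrderIn.exists_nsmul_mem_of_fintype {A : Type*} [Ring A] [Algebra ℚ A] {O : Subring A}
    (hO : IsOrderIn O) {ι : Type*} [Fintype ι] (a : ι → A) :
    ∃ k : ℕ, k ≠ 0 ∧ ∀ i, k • a i ∈ O := by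
  classical
  choose k hk hmem using fun i => hO.exists_nsmul_mem (a i)
  refine ⟨∏ i, k i, Finset.prod_ne_zero_iff.mpr fun i _ => hk i, fun i => ?_⟩
  rw [← Finset.prod_erase_mul _ _ (Finset.mem_univ i), mul_smul]
  exact O.nsmul_mem (hmem i) _

theorem Matrix.map_intCast_injective :
    Function.Injective
      (fun y : Matrix (Fin 2) (Fin 2) ℤ => y.map (Int.castRingHom ℚ)) :=
  Matrix.map_injective Int.cast_injective

namespace WedderburnDecomposition

variable {A : Type u} [Ring A] [Algebra ℚ A] (W : WedderburnDecomposition A) {i : Fin W.m}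
  (O : Subring A)

/-- A component isomorphic to `M₂(ℚ)` can be identified with `M₂(ℚ)` such that the order `O` is
mapped to integral matrices. -/
theorem exists_algEquiv_integral (hO : IsOrderIn O)
    (hi : Nonempty (W.Component i ≃ₐ[ℚ] Matrix (Fin 2) (Fin 2) ℚ)) :
    ∃ φ : W.Component i ≃ₐ[ℚ] Matrix (Fin 2) (Fin 2) ℚ, ∀ a ∈ O,
      ∃ y : Matrix (Fin 2) (Fin 2) ℤ, φ (W.proj i a) = y.map (Int.castRingHom ℚ) := by
  obtain ⟨ψ⟩ := hi
  let f : A →+* Matrix (Fin 2) (Fin 2) ℚ := (ψ.toAlgHom.comp (W.proj i)).toRingHom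
  have hfg : (O.map f).toAddSubgroup.FG := by
    rw [AddSubgroup.fg_iff_addSubmonoid_fg]
    exact ((AddSubgroup.fg_iff_addSubmonoid_fg _).mp hO.fg).map f.toAddMonoidHom
  obtain ⟨θ, hθ⟩ := exists_algEquiv_forall_integral (O.map f) hfg
  exact ⟨ψ.trans θ, fun a ha => hθ _ ⟨a, ha, rfl⟩⟩

/-- The homomorphism `SL₁(O) → SL₂(ℤ)` given by a component isomorphic to `M₂(ℚ)`. -/
theorem exists_hom_SL (φ : W.Component i ≃ₐ[ℚ] Matrix (Fin 2) (Fin 2) ℚ)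
    (hφ : ∀ a ∈ O, ∃ y : Matrix (Fin 2) (Fin 2) ℤ,
      φ (W.proj i a) = y.map (Int.castRingHom ℚ)) :
    ∃ Ψ : W.SL1 O →* Matrix.SpecialLinearGroup (Fin 2) ℤ, ∀ a : W.SL1 O,
      φ (W.proj i (((a : Oˣ) : O) : A)) =
        (Ψ a : Matrix (Fin 2) (Fin 2) ℤ).map (Int.castRingHom ℚ) := by
  choose y hy using fun a : O => hφ a a.2
  have hdet : ∀ a : W.SL1 O, (y ((a : Oˣ) : O)).det = 1 := by
    intro a
    have h := (reducedNorm_eq_one_iff φ _).mp (a.2 i)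
    have h' : ((y ((a : Oˣ) : O)).det : ℚ) = 1 := by
      rw [← h, hy, ← eq_intCast (Int.castRingHom ℚ), RingHom.map_det]
      rfl
    exact_mod_cast h'
  refine ⟨MonoidHom.mk' (fun a => ⟨y ((a : Oˣ) : O), hdet a⟩) fun a b => ?_, fun a => hy _⟩
  refine Subtype.ext (Matrix.map_intCast_injective ?_)
  change (y _).map (Int.castRingHom ℚ) = (y _ * y _).map (Int.castRingHom ℚ)
  rw [Matrix.map_mul, ← hy, ← hy, ← hy, ← map_mul, ← map_mul]
  rfl

/-- The multiplicative map from `SL₂(ℤ)` to `A` at a component isomorphic to `M₂(ℚ)`; the other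
components of its values are `1`. -/
def ofSL (φ : W.Component i ≃ₐ[ℚ] Matrix (Fin 2) (Fin 2) ℚ) :
    Matrix.SpecialLinearGroup (Fin 2) ℤ →* A :=
  (W.equiv.symm : ((j : Fin W.m) → W.Component j) →* A).comp <|
    (MonoidHom.mulSingle (fun j => W.Component j) i).comp <|
      (φ.symm : Matrix (Fin 2) (Fin 2) ℚ →* W.Component i).comp <|
        ((Int.castRingHom ℚ).mapMatrix (m := Fin 2)).toMonoidHom.comp
          { toFun := fun g => (g : Matrix (Fin 2) (Fin 2) ℤ)
            map_one' := rfl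
            map_mul' := fun _ _ => rfl }

theorem equiv_ofSL (φ : W.Component i ≃ₐ[ℚ] Matrix (Fin 2) (Fin 2) ℚ)
    (g : Matrix.SpecialLinearGroup (Fin 2) ℤ) :
    W.equiv (W.ofSL φ g) = Pi.mulSingle i
      (φ.symm ((g : Matrix (Fin 2) (Fin 2) ℤ).map (Int.castRingHom ℚ))) :=
  W.equiv.apply_symm_apply _

/-- The image of `SL₁(O)` in `SL₂(ℤ)` contains a principal congruence subgroup. -/
theorem exists_Gamma_le_range (hO : IsOrderIn O)
    (φ : W.Component i ≃ₐ[ℚ] Matrix (Fin 2) (Fin 2) ℚ)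
    (Ψ : W.SL1 O →* Matrix.SpecialLinearGroup (Fin 2) ℤ)
    (hΨ : ∀ a : W.SL1 O, φ (W.proj i (((a : Oˣ) : O) : A)) =
        (Ψ a : Matrix (Fin 2) (Fin 2) ℤ).map (Int.castRingHom ℚ)) :
    ∃ N : ℕ, N ≠ 0 ∧ CongruenceSubgroup.Gamma N ≤ Ψ.range := by
  let j : Matrix (Fin 2) (Fin 2) ℚ →+ A :=
    (W.equiv.symm : _ →+ A).comp <|
      (AddMonoidHom.single (fun j => W.Component j) i).comp (φ.symm : _ →+ W.Component i)
  -- `N` clears the denominators of the four matrix units placed in component `i`.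
  obtain ⟨N, hN, hmem⟩ := hO.exists_nsmul_mem_of_fintype
    fun p : Fin 2 × Fin 2 => j (Matrix.single p.1 p.2 1)
  have hint : ∀ y : Matrix (Fin 2) (Fin 2) ℤ, N • j (y.map (Int.castRingHom ℚ)) ∈ O := by
    intro y
    have : y.map (Int.castRingHom ℚ) = ∑ k, ∑ l, y k l • Matrix.single k l (1 : ℚ) := by
      conv_lhs => rw [Matrix.matrix_eq_sum_single (y.map (Int.castRingHom ℚ))]
      simp [Matrix.smul_single]
    rw [this, map_sum, Finset.smul_sum]
    refine O.sum_mem fun k _ => ?_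
    rw [map_sum, Finset.smul_sum]
    refine O.sum_mem fun l _ => ?_
    rw [map_zsmul, smul_comm]
    exact O.zsmul_mem (hmem (k, l)) _
  have hO' : ∀ g ∈ CongruenceSubgroup.Gamma N, W.ofSL φ g ∈ O := by
    intro g hg
    have hy : ∃ y : Matrix (Fin 2) (Fin 2) ℤ,
        (g : Matrix (Fin 2) (Fin 2) ℤ) = 1 + N • y := by
      rw [CongruenceSubgroup.Gamma_mem'] at hg
      have h : ∀ k l, ∃ c : ℤ, g k l = (1 : Matrix (Fin 2) (Fin 2) ℤ) k l + N * c := by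
        intro k l
        have h1 := congrFun₂ (congrArg Subtype.val hg) k l
        have h2 : ((g k l : ℤ) : ZMod N) =
            (((1 : Matrix (Fin 2) (Fin 2) ℤ) k l : ℤ) : ZMod N) := by
          refine Eq.trans h1 ?_
          by_cases h : k = l <;> simp [h, Matrix.one_apply]
        obtain ⟨c, hc⟩ := ((ZMod.intCast_eq_intCast_iff_dvd_sub _ _ _).mp h2.symm)
        exact ⟨c, by rw [← hc]; ring⟩
      choose c hc using h
      exact ⟨Matrix.of c, by ext k l; simp [hc]⟩
    obtain ⟨y, hy⟩ := hy
    -- Extended by `1`, not by `0`, the matrix `1 + N • y` differs from the unit of `A` only by `N`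
    -- times an integral matrix in component `i`.
    have : W.ofSL φ g = 1 + N • j (y.map (Int.castRingHom ℚ)) := by
      apply W.equiv.injective
      rw [equiv_ofSL, hy, map_add, map_one, map_nsmul]
      change _ = 1 + N • W.equiv (W.equiv.symm (Pi.single i _))
      rw [AlgEquiv.apply_symm_apply]
      have hm : (1 + N • y).map (Int.castRingHom ℚ) = 1 + N • y.map (Int.castRingHom ℚ) := by
        rw [Matrix.map_add _ (map_add _), Matrix.map_one _ (map_zero _) (map_one _),
          ← RingHom.mapMatrix_apply, map_nsmul, RingHom.mapMatrix_apply]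
      rw [hm, map_add, map_one, map_nsmul]
      funext k
      by_cases h : k = i
      · subst h; simp
      · simp [h]
    rw [this]
    exact O.add_mem O.one_mem (hint y)
  refine ⟨N, hN, fun g hg => ?_⟩
  let a : Oˣ :=
    { val := ⟨W.ofSL φ g, hO' g hg⟩
      inv := ⟨W.ofSL φ g⁻¹, hO' _ (inv_mem hg)⟩
      val_inv := Subtype.ext (by
        change W.ofSL φ g * W.ofSL φ g⁻¹ = 1
        rw [← map_mul, mul_inv_cancel, map_one])
      inv_val := Subtype.ext (by
        change W.ofSL φ g⁻¹ * W.ofSL φ g = 1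
        rw [← map_mul, inv_mul_cancel, map_one]) }
  have hproj : ∀ k, W.proj k ((a : O) : A) = Pi.mulSingle (M := fun j => W.Component j) i
      (φ.symm ((g : Matrix (Fin 2) (Fin 2) ℤ).map (Int.castRingHom ℚ))) k := fun k =>
    congrFun (W.equiv_ofSL φ g) k
  have ha : a ∈ W.SL1 O := by
    intro k
    rw [hproj]
    by_cases h : k = i
    · subst h
      rw [Pi.mulSingle_eq_same, reducedNorm_eq_one_iff φ, AlgEquiv.apply_symm_apply]
      have := (Int.castRingHom ℚ).map_det (g : Matrix (Fin 2) (Fin 2) ℤ)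
      rw [g.2, map_one] at this
      exact this.symm
    · rw [Pi.mulSingle_eq_of_ne h, map_one]
  refine ⟨⟨a, ha⟩, Subtype.ext (Matrix.map_intCast_injective ?_)⟩
  refine (hΨ ⟨a, ha⟩).symm.trans ?_
  rw [hproj, Pi.mulSingle_eq_same, AlgEquiv.apply_symm_apply]

end WedderburnDecomposition

/-! ### Assembly of the surjection from `H` onto a free product -/

theorem proposition6p10 {A : Type u} [Ring A] [Algebra ℚ A] [FiniteDimensional ℚ A]
    [IsSemisimpleRing A] (W : WedderburnDecomposition A)
    (hW : ∃ i, Nonempty (W.Component i ≃ₐ[ℚ] Matrix (Fin 2) (Fin 2) ℚ))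
    (O : Subring A) (hO : IsOrderIn O) (H : Subgroup (W.SL1 O)) (hH : H.FiniteIndex) :
    HasNontrivialAmalgamatedDecomposition H := by
  obtain ⟨i, hi⟩ := hW
  obtain ⟨φ, hφ⟩ := W.exists_algEquiv_integral O hO hi
  obtain ⟨Ψ, hΨ⟩ := W.exists_hom_SL O φ hφ
  obtain ⟨N, hN, hle⟩ := W.exists_Gamma_le_range O hO φ Ψ hΨ
  obtain ⟨p, hp⟩ := exists_surjective_freeProductTwoThree
  have : NeZero N := ⟨hN⟩
  have hΨfin : Ψ.range.FiniteIndex := Subgroup.finiteIndex_of_le hle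
  have hfin : ((H.map Ψ).map p).FiniteIndex := by
    constructor
    -- The index of an image is the index of the join with the kernel times the index of the range.
    rw [Subgroup.index_map, Subgroup.index_eq_one.mpr (MonoidHom.range_eq_top.mpr hp), mul_one]
    have h₁ : (H.map Ψ).FiniteIndex := by
      constructor
      rw [Subgroup.index_map]
      have : (H ⊔ Ψ.ker).FiniteIndex := Subgroup.finiteIndex_of_le le_sup_left
      exact mul_ne_zero Subgroup.FiniteIndex.index_ne_zero hΨfin.index_ne_zero
    have : (H.map Ψ ⊔ p.ker).FiniteIndex := Subgroup.finiteIndex_of_le le_sup_left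
    exact Subgroup.FiniteIndex.index_ne_zero
  obtain ⟨M, M', _, _, _, _, q, hq⟩ :=
    FreeProductTwoThree.exists_surjective_of_finiteIndex ((H.map Ψ).map p)
  exact .of_surjective (q.comp ((p.subgroupMap (H.map Ψ)).comp (Ψ.subgroupMap H)))
    (hq.comp ((p.subgroupMap_surjective _).comp (Ψ.subgroupMap_surjective _)))
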